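/- Consider $S\ge 2$ non-colluding servers, each storing the same $N\ge 1$ files $W_1,\dots,W_N$ (independent, uniformly distributed, of $F$ bits each; $F$ bits are one unit), $C$ caches, each able to store $M$ files ($MF$ bits), and $K=C$ users, where user $k$ accesses the $L$ caches $k,k+1,\dots,k+L-1$ (indices modulo $C$), $1\le L<C$. A scheme with file size $F\ge 1$ consists of the following. - Placement: each cache content $Z_c$ is a function of the files and takes at most $2^{MF}$ values. - Delivery: user $k$ demands the file $W_{d_k}$, $d_k\in\{1,\dots,N\}$. From the demand vector $\mathbf d=(d_1,\dots,d_K)$ and private randomness that is independent of the files and of $\mathbf d$, the users jointly generate queries $Q_1,\dots,Q_S$. Server $s$ receives $Q_s$ and broadcasts an answer $A_s$, a function of $Q_s$ and of the files. The following is required for every probability distribution of $\mathbf d$ (independent of the files). - Privacy: $I(\mathbf d;Q_s,Z_1,\dots,Z_C)=0$ for every server $s$. - Correctness: $H(W_{d_k}\mid \mathbf d,\,Z_k,\dots,Z_{k+L-1},\,Q_1,\dots,Q_S,\,A_1,\dots,A_S)=0$ for every user $k$ (cache indices modulo $C$). The scheme has rate at most $R$ if $\sum_{s=1}^S H(A_s)\le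 R\cdot F$ (entropies in bits) for every distribution of $\mathbf d$, in particular for every fixed demand vector. The rate $R$ is achievable if, for some $F\ge1$, there is such a scheme of rate at most $R$. For integers $n,k$ and $m\le n$ let $\mathrm{cyc}(n,k,m)$ be the number of $k$-element subsets of $n$ distinguishable elements arranged in a circle that contain $m$ cyclically consecutive elements. **Theorem.** If $t=CM/N$ is an integer with $0\le t\le C$, then the rate $$R(t)=\min\Big\{\frac{C-t}{t+1},\ \frac{\mathrm{cyc}(C,t+L,L)}{\binom{C}{t}}\Big\}\Big(1+\frac1S+\dots+\frac1{S^{N-1}}\Big)$$ is achievable. -/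

import Mathlib

namespace MuPIR

/-! ### Entropy of random variables on a finite probability space

A finite probability space is a finite type `Ω` with a mass function `p ∈ stdSimplex ℝ Ω`. -/

section Entropy

variable {Ω α β : Type} [Fintype Ω] [Fintype α] [Fintype β]

open Classical in
/-- `P(X = x)`. -/
noncomputable def prob (p : Ω → ℝ) (X : Ω → α) (x : α) : ℝ :=
  ∑ ω, if X ω = x then p ω else 0

/-- The Shannon entropy `H(X)`, in bits. -/
noncomputable def entropy (p : Ω → ℝ) (X : Ω → α) : ℝ :=
  (∑ x, Real.negMulLog (prob p X x)) / Real.log 2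

/-- The conditional entropy `H(X | Y) = H(X, Y) - H(Y)`. -/
noncomputable def condEntropy (p : Ω → ℝ) (X : Ω → α) (Y : Ω → β) : ℝ :=
  entropy p (fun ω => (X ω, Y ω)) - entropy p Y

/-- The mutual information `I(X ; Y) = H(X) + H(Y) - H(X, Y)`. -/
noncomputable def mutualInfo (p : Ω → ℝ) (X : Ω → α) (Y : Ω → β) : ℝ :=
  entropy p X + entropy p Y - entropy p (fun ω => (X ω, Y ω))

end Entropy

/-! ### The multi-access cache-aided private retrieval problem -/

/-- The contents of `N` files of `F` bits each. -/
abbrev Files (N F : ℕ) : Type := Fin N → Fin F → Bool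

/-- A demand vector: each of the `K` users picks the index of one of the `N` files. -/
abbrev Demand (K N : ℕ) : Type := Fin K → Fin N

/-- A placement and delivery scheme for `S` servers, `N` files of `F` bits, `C` caches and
`K` users. The cache contents are functions of the files only. The users jointly generate the
queries from the demand vector and from private randomness, and each server answers with a
function of the query that it received and of the files. -/
structure Scheme (S N C K F : ℕ) where
  /-- possible contents of each cache -/
  Cache : Fin C → Type
  [cacheFintype : ∀ c, Fintype (Cache c)]
  /-- placement phase -/
  place : ∀ c, Files N F → Cache c
  /-- private randomness shared by the users, with its law -/
  Rand : Type
  [randFintype : Fintype Rand]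
  law : Rand → ℝ
  law_mem : law ∈ stdSimplex ℝ Rand
  /-- possible queries to each server -/
  Query : Fin S → Type
  [queryFintype : ∀ s, Fintype (Query s)]
  query : ∀ s, Demand K N → Rand → Query s
  /-- possible broadcasts of each server -/
  Answer : Fin S → Type
  [answerFintype : ∀ s, Fintype (Answer s)]
  answer : ∀ s, Query s → Files N F → Answer s

attribute [instance] Scheme.cacheFintype Scheme.randFintype Scheme.queryFintype
  Scheme.answerFintype

namespace Scheme

variable {S N C K F : ℕ} (σ : Scheme S N C K F)

/-- Outcomes: the demand vector, the files, and the private randomness of the users. -/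
abbrev Outcome : Type := Demand K N × Files N F × σ.Rand

/-- The joint law in which the demand vector has law `prior`, the files are independent and
uniformly distributed, the users' randomness has law `σ.law`, and these three are independent. -/
noncomputable def mass (prior : Demand K N → ℝ) (ω : σ.Outcome) : ℝ :=
  prior ω.1 * (1 / (Fintype.card (Files N F) : ℝ)) * σ.law ω.2.2

/-- The contents of the caches in the set `A`. -/
def caches (A : Finset (Fin C)) (ω : σ.Outcome) : ∀ c : {c // c ∈ A}, σ.Cache c.1 :=
  fun c => σ.place c.1 ω.2.1

/-- The query to server `s`. -/
def queryVar (s : Fin S) (ω : σ.Outcome) : σ.Query s := σ.query s ω.1 ω.2.2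

/-- The broadcast of server `s`. -/
def answerVar (s : Fin S) (ω : σ.Outcome) : σ.Answer s := σ.answer s (σ.queryVar s ω) ω.2.1

/-- Every cache stores at most `M` files, that is, at most `M * F` bits. -/
def FitsMemory (M : ℝ) : Prop :=
  ∀ c, Real.logb 2 (Fintype.card (σ.Cache c)) ≤ M * F

/-- Privacy: whatever the law of the demand vector, no server gets any information on it from
its query and the contents of all the caches, `I(d ; Q_s, Z_1, …, Z_C) = 0`. -/
def IsPrivate : Prop :=
  ∀ prior ∈ stdSimplex ℝ (Demand K N), ∀ s : Fin S,
    mutualInfo (σ.mass prior) (fun ω => ω.1)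
      (fun ω => (σ.queryVar s ω, σ.caches Finset.univ ω)) = 0

/-- Correctness: each user `k` can decode its file from the demand vector, the caches that it
accesses, the queries (which the users generated) and the broadcasts of all the servers,
`H(W_{d_k} | d, Z_{access k}, Q_1, …, Q_S, A_1, …, A_S) = 0`. -/
def IsCorrect (access : Fin K → Finset (Fin C)) : Prop :=
  ∀ prior ∈ stdSimplex ℝ (Demand K N), ∀ k : Fin K,
    condEntropy (σ.mass prior) (fun ω => ω.2.1 (ω.1 k))
      (fun ω => (ω.1, σ.caches (access k) ω, (fun s => σ.queryVar s ω),
        (fun s => σ.answerVar s ω))) = 0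

/-- The rate `H(A_1) + … + H(A_S)` in units of one file, when the demand vector has law `prior`
(a point mass for a fixed demand vector). -/
noncomputable def rate (prior : Demand K N → ℝ) : ℝ :=
  (∑ s, entropy (σ.mass prior) (σ.answerVar s)) / F

end Scheme

/-- With `S` servers, `N` files, caches of size `M` files, and users that access the caches
described by `access`, private retrieval is possible with rate (at most) `R`, for every demand. -/
def Achievable (S N : ℕ) {C K : ℕ} (M : ℝ) (access : Fin K → Finset (Fin C)) (R : ℝ) : Prop :=
  ∃ F : ℕ, 0 < F ∧ ∃ σ : Scheme S N C K F,
    σ.FitsMemory M ∧ σ.IsPrivate ∧ σ.IsCorrect access ∧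
      ∀ prior ∈ stdSimplex ℝ (Demand K N), σ.rate prior ≤ R

/-! ### Cyclic wraparound -/

/-- The cyclically consecutive positions `j, j + 1, …, j + m - 1` modulo `n`. -/
def window (n m : ℕ) (j : Fin n) : Finset (Fin n) :=
  Finset.univ.filter fun c => ∃ i < m, c.val = (j.val + i) % n

/-- The number of `k`-element subsets of `n` elements arranged in a circle that contain `m`
cyclically consecutive elements (`m ≤ n`). -/
def cyc (n k m : ℕ) : ℕ :=
  (((Finset.univ : Finset (Fin n)).powersetCard k).filter fun A =>
    ∃ j, window n m j ⊆ A).card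

end MuPIR

/-! Coded caching is combined with a private retrieval code. Each file is cut into parts indexed by
the `t`-subsets `T` of caches, and cache `c` stores the parts with `c ∈ T`. For a user with no
access to the caches of `T`, some multicast message carries its part `T`, mixed only with parts that
this user has cached (`DeliveryDesign.covers`).

Each message is retrieved privately with one random vector per user, used for all messages. Server
`s` answers the nonzero tuples `q` of sum `s`, one entry per file. User `k` hides its demand by
sending `r k + queryShift (d k) s`, which is uniform for each single server. Within one instance,
the `S` tuples differ only in the entry of the demanded file, which takes every value. The value
whose symbol is `0` exposes the interference, and the others then yield the file (`retrieve`). A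
message costs `S ^ (n + 1) - 1` bits over all servers, against `S ^ n * (S - 1)` bits per part; the
ratio is the geometric sum. The two terms of the minimum count the messages of two designs. -/

namespace MuPIR

/-! ### Entropy, determination and independence -/

section Entropy

variable {Ω α β : Type} [Fintype Ω]

theorem sum_prob [Fintype α] (p : Ω → ℝ) (X : Ω → α) : ∑ x, prob p X x = ∑ ω, p ω := by
  classical
  unfold prob
  rw [Finset.sum_comm]
  refine Finset.sum_congr rfl fun ω _ => ?_
  simp

theorem prob_nonneg {p : Ω → ℝ} (hp : ∀ ω, 0 ≤ p ω) (X : Ω → α) (x : α) : 0 ≤ prob p X x := by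
  unfold prob
  refine Finset.sum_nonneg fun ω _ => ?_
  split_ifs
  exacts [hp ω, le_rfl]

theorem sum_prob_pair_right [Fintype β] (p : Ω → ℝ) (X : Ω → α) (Y : Ω → β) (x : α) :
    ∑ y, prob p (fun ω => (X ω, Y ω)) (x, y) = prob p X x := by
  classical
  unfold prob
  rw [Finset.sum_comm]
  refine Finset.sum_congr rfl fun ω _ => ?_
  by_cases h : X ω = x <;> simp [h]

theorem sum_prob_pair_left [Fintype α] (p : Ω → ℝ) (X : Ω → α) (Y : Ω → β) (y : β) :
    ∑ x, prob p (fun ω => (X ω, Y ω)) (x, y) = prob p Y y := by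
  classical
  unfold prob
  rw [Finset.sum_comm]
  refine Finset.sum_congr rfl fun ω _ => ?_
  by_cases h : Y ω = y <;> simp [h]

/-- The entropy of a random variable is at most the logarithm of the number of its values. -/
theorem entropy_le_logb_card [Fintype α] {p : Ω → ℝ} (hp : p ∈ stdSimplex ℝ Ω) (X : Ω → α) :
    entropy p X ≤ Real.logb 2 (Fintype.card α) := by
  have hne : Nonempty Ω := by
    by_contra h
    rw [not_nonempty_iff] at h
    have := hp.2
    simp at this
  have : Nonempty α := hne.map X
  have hc : (0 : ℝ) < Fintype.card α := by exact_mod_cast Fintype.card_pos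
  have h := Real.concaveOn_negMulLog.le_map_sum (t := Finset.univ)
    (w := fun _ : α => (Fintype.card α : ℝ)⁻¹) (p := prob p X)
    (fun _ _ => by positivity) (by simp [hc.ne']) (fun x _ => prob_nonneg hp.1 X x)
  simp only [smul_eq_mul, ← Finset.mul_sum, sum_prob, hp.2, mul_one] at h
  rw [Real.negMulLog, Real.log_inv, neg_mul_neg] at h
  unfold entropy Real.logb
  gcongr
  exact le_of_mul_le_mul_left h (by positivity)

/-- A random variable determined by another one has zero entropy conditionally on it. -/
theorem condEntropy_eq_zero [Fintype α] [Fintype β] (p : Ω → ℝ) (X : Ω → α) (Y : Ω → β)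
    (h : ∀ ω ω', Y ω = Y ω' → X ω = X ω') : condEntropy p X Y = 0 := by
  classical
  unfold condEntropy entropy
  rw [← sub_div, Fintype.sum_prod_type, Finset.sum_comm, ← Finset.sum_sub_distrib]
  rw [Finset.sum_eq_zero, zero_div]
  intro y _
  by_cases hy : ∃ ω₀, Y ω₀ = y
  · obtain ⟨ω₀, rfl⟩ := hy
    rw [Finset.sum_eq_single (X ω₀), sub_eq_zero]
    · congr 1
      unfold prob
      refine Finset.sum_congr rfl fun ω _ => ?_
      by_cases hω : Y ω = Y ω₀
      · simp [hω, h ω ω₀ hω]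
      · simp [hω]
    · intro x _ hx
      rw [show prob p (fun ω => (X ω, Y ω)) (x, Y ω₀) = 0 from ?_, Real.negMulLog_zero]
      refine Finset.sum_eq_zero fun ω _ => if_neg ?_
      rintro hω
      obtain ⟨h1, h2⟩ := Prod.mk.inj hω
      exact hx (h1 ▸ h ω ω₀ h2)
    · simp
  · push Not at hy
    have h1 : prob p Y y = 0 := Finset.sum_eq_zero fun ω _ => if_neg (hy ω)
    have h2 : ∀ x, prob p (fun ω => (X ω, Y ω)) (x, y) = 0 := fun x =>
      Finset.sum_eq_zero fun ω _ => if_neg fun hω => hy ω (Prod.mk.inj hω).2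
    simp [h1, h2]

/-- Random variables whose joint mass function is a product are independent. -/
theorem mutualInfo_eq_zero [Fintype α] [Fintype β] {p : Ω → ℝ} (hp : ∑ ω, p ω = 1) (X : Ω → α) (Y : Ω → β)
    (a : α → ℝ) (b : β → ℝ)
    (h : ∀ x y, prob p (fun ω => (X ω, Y ω)) (x, y) = a x * b y) : mutualInfo p X Y = 0 := by
  have hX : ∀ x, prob p X x = a x * ∑ y, b y := fun x => by
    rw [← sum_prob_pair_right p X Y, Finset.mul_sum]
    exact Finset.sum_congr rfl fun y _ => h x y
  have hY : ∀ y, prob p Y y = (∑ x, a x) * b y := fun y => by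
    rw [← sum_prob_pair_left p X Y, Finset.sum_mul]
    exact Finset.sum_congr rfl fun x _ => h x y
  -- The factors need not be normalised separately; only the product of their total masses is `1`.
  have hAB : (∑ x, a x) * ∑ y, b y = 1 := by
    rw [Finset.sum_mul, ← hp, ← sum_prob p X]
    exact Finset.sum_congr rfl fun x _ => (hX x).symm
  have hXY : ∀ x y, prob p (fun ω => (X ω, Y ω)) (x, y) = prob p X x * prob p Y y := fun x y => by
    rw [h, hX, hY]
    linear_combination (-(a x * b y)) * hAB
  have key : ∑ z, Real.negMulLog (prob p (fun ω => (X ω, Y ω)) z) =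
      ∑ x, Real.negMulLog (prob p X x) + ∑ y, Real.negMulLog (prob p Y y) := by
    rw [Fintype.sum_prod_type]
    simp only [hXY, Real.negMulLog_mul, Finset.sum_add_distrib, ← Finset.mul_sum,
      ← Finset.sum_mul, sum_prob, hp, one_mul]
  unfold mutualInfo entropy
  rw [key]
  ring

end Entropy

/-! ### A criterion for privacy -/

namespace Scheme

variable {S N C K F : ℕ} (σ : Scheme S N C K F)

theorem mass_mem {prior : Demand K N → ℝ} (h : prior ∈ stdSimplex ℝ (Demand K N)) :
    σ.mass prior ∈ stdSimplex ℝ σ.Outcome := by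
  refine ⟨fun ω => mul_nonneg (mul_nonneg (h.1 _) (by positivity)) (σ.law_mem.1 _), ?_⟩
  unfold mass
  rw [Fintype.sum_prod_type]
  simp only [Fintype.sum_prod_type, ← Finset.mul_sum, ← Finset.sum_mul, σ.law_mem.2, h.2]
  simp

/-- A scheme is private if the law of each query does not depend on the demand vector. -/
theorem isPrivate_of_query_law (c : ∀ s, σ.Query s → ℝ)
    (h : ∀ s d u, prob σ.law (σ.query s d) u = c s u) : σ.IsPrivate := by
  classical
  intro prior hprior s
  refine mutualInfo_eq_zero (σ.mass_mem hprior).2 _ _ prior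
    -- The caches depend on the files alone, so their law splits off from that of the query.
    (fun y => c s y.1 * ∑ W : Files N F,
      if (fun x : {x // x ∈ (Finset.univ : Finset (Fin C))} => σ.place x.1 W) = y.2
        then 1 / (Fintype.card (Files N F) : ℝ) else 0) ?_
  rintro δ ⟨u, z⟩
  unfold prob
  rw [Fintype.sum_prod_type, Finset.sum_eq_single δ]
  · rw [Fintype.sum_prod_type, ← h s δ u, prob, Finset.mul_sum, Finset.mul_sum]
    refine Finset.sum_congr rfl fun W _ => ?_
    rw [Finset.sum_mul, Finset.mul_sum]
    refine Finset.sum_congr rfl fun r _ => ?_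
    by_cases h1 : σ.query s δ r = u
    · by_cases h2 : (fun x : {x // x ∈ (Finset.univ : Finset (Fin C))} => σ.place x.1 W) = z
      · rw [if_pos h2, if_pos h1, if_pos]
        · simp only [mass]
          ring
        · simp only [queryVar, h1]
          exact congrArg (fun z => (δ, u, z)) h2
      · rw [if_neg h2, if_neg]
        · ring
        · exact fun he => h2 (Prod.mk.inj (Prod.mk.inj he).2).2
    · rw [if_neg h1, if_neg]
      · ring
      · exact fun he => h1 (Prod.mk.inj (Prod.mk.inj he).2).1
  · intro d _ hd
    refine Finset.sum_eq_zero fun y _ => if_neg fun he => hd (Prod.mk.inj he).1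
  · simp

end Scheme

end MuPIR

namespace MuPIR

/-! ### Retrieval by one user -/

/-- The vector whose entry `d - 1` is `s` and whose other entries are `0`; it vanishes for
`d = 0`. -/
def queryShift {G : Type*} [Zero G] {n : ℕ} (d : Fin (n + 1)) (s : G) : Fin n → G :=
  Fin.tail (Pi.single d s : Fin (n + 1) → G)

/-- Consider the symbols `V m i j` of files `m`, in instances `i`. The file `d` can be recovered
from the sums over `m` of the symbols `q m` of the instances `tail q - (r + queryShift d (∑ q))`. -/
theorem retrieve {G A : Type*} [AddCommGroup G] [AddCommGroup A] {n : ℕ}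
    (V : Fin (n + 1) → (Fin n → G) → G → A) (hV : ∀ m i, V m i 0 = 0) (d : Fin (n + 1))
    (r : Fin n → G)
    (h : ∀ q : Fin (n + 1) → G,
      ∑ m, V m (Fin.tail q - (r + queryShift d (∑ l, q l))) (q m) = 0)
    (i : Fin n → G) (j : G) : V d i j = 0 := by
  -- Entry `0` makes the total zero, so `b + Pi.single d s` has sum `s` and belongs to instance `i`
  -- for every `s`.
  set b : Fin (n + 1) → G := Fin.cons (-∑ l, (i l + r l)) (i + r) with hb
  have hsum : ∑ l, b l = 0 := by
    simp [hb, Fin.sum_univ_succ]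
  have key : ∀ s, (∑ m ∈ Finset.univ.erase d, V m i (b m)) + V d i (b d + s) = 0 := by
    intro s
    have hq : ∑ l, (b + Pi.single d s : Fin (n + 1) → G) l = s := by
      simp only [Pi.add_apply, Finset.sum_add_distrib, hsum, Finset.sum_pi_single', zero_add,
        Finset.mem_univ, if_true]
    have hi : Fin.tail (b + Pi.single d s : Fin (n + 1) → G) -
        (r + queryShift d s) = i := by
      ext l
      simp [queryShift, Fin.tail, hb]
    have := h (b + Pi.single d s)
    rw [hq, hi, ← Finset.sum_erase_add _ _ (Finset.mem_univ d)] at this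
    rw [← this]
    congr 1
    · refine Finset.sum_congr rfl fun m hm => ?_
      simp [Finset.ne_of_mem_erase hm]
    · simp
  -- This shift makes entry `d` zero, which isolates the interference; the next one makes it `j`.
  have h0 := key (-b d)
  have h1 := key (j - b d)
  rw [add_neg_cancel, hV, add_zero] at h0
  rwa [h0, zero_add, add_sub_cancel] at h1

/-! ### Splitting the files -/

/-- The pieces of a file: a file is split according to the sets of `t` caches that store a part,
each part is split according to the instances of a retrieval scheme for `n + 1` files and `S`
servers, and the part of each instance consists of `S - 1` bits. -/
abbrev Piece (C t S n : ℕ) [NeZero S] : Type :=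
  {T : Finset (Fin C) // T.card = t} × (Fin n → Fin S) × {j : Fin S // j ≠ 0}

theorem card_piece (C t S n : ℕ) [NeZero S] :
    Fintype.card (Piece C t S n) = C.choose t * (S ^ n * (S - 1)) := by
  simp [Piece]

/-- The sets avoiding `c` are the `t`-subsets of the other `C - 1` points; removing them leaves the
fraction `t / C`. -/
theorem card_filter_mem_powersetCard (C t : ℕ) (c : Fin C) :
    (((Finset.univ : Finset (Fin C)).powersetCard t).filter fun T => c ∈ T).card * C =
      t * C.choose t := by
  obtain ⟨m, rfl⟩ : ∃ m, C = m + 1 := ⟨C - 1, by have := c.2; lia⟩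
  have h1 := Finset.card_filter_add_card_filter_not
    (s := (Finset.univ : Finset (Fin (m + 1))).powersetCard t) (fun T => c ∈ T)
  have h2 : ((Finset.univ : Finset (Fin (m + 1))).powersetCard t).filter (fun T => c ∉ T) =
      (Finset.univ.erase c).powersetCard t := by
    ext T
    simp only [Finset.mem_filter, Finset.mem_powersetCard, Finset.subset_erase]
    tauto
  rw [h2, Finset.card_powersetCard, Finset.card_powersetCard, Finset.card_erase_of_mem
    (Finset.mem_univ c), Finset.card_univ, Fintype.card_fin, Nat.add_sub_cancel] at h1
  have h3 := Nat.choose_mul_succ_eq m t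
  rcases le_or_gt t (m + 1) with ht | ht
  · obtain ⟨k, hk⟩ := Nat.exists_eq_add_of_le ht
    rw [hk, Nat.add_sub_cancel_left, ← hk] at h3
    rw [← h1] at h3 ⊢
    have : (m + 1 : ℤ) = t + k := by exact_mod_cast hk
    zify at h3 ⊢
    rw [this] at h3 ⊢
    linear_combination -h3
  · rw [Nat.choose_eq_zero_of_lt ht] at h1 ⊢
    simp [(Nat.add_eq_zero_iff.1 h1).1]

theorem sum_range_one_div_pow {x : ℝ} (hx : 1 < x) (n : ℕ) :
    ∑ i ∈ Finset.range (n + 1), 1 / x ^ i = (x ^ (n + 1) - 1) / (x ^ n * (x - 1)) := by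
  have h : x - 1 ≠ 0 := by linarith
  have h' : x ≠ 0 := by linarith
  induction n with
  | zero => simp [h]
  | succ n ih =>
    rw [Finset.sum_range_succ, ih]
    field_simp
    ring

theorem card_pieces_stored (C t S n : ℕ) [NeZero S] (c : Fin C) :
    Fintype.card {x : Fin (Fintype.card (Piece C t S n)) //
      c ∈ ((Fintype.equivFin (Piece C t S n)).symm x).1.1} * C =
      t * Fintype.card (Piece C t S n) := by
  have h : Fintype.card {x : Fin (Fintype.card (Piece C t S n)) //
      c ∈ ((Fintype.equivFin (Piece C t S n)).symm x).1.1} =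
      (((Finset.univ : Finset (Fin C)).powersetCard t).filter fun T => c ∈ T).card *
        (S ^ n * (S - 1)) := by
    rw [Fintype.card_congr ((Fintype.equivFin (Piece C t S n)).symm.subtypeEquiv
      (p := fun x => c ∈ ((Fintype.equivFin (Piece C t S n)).symm x).1.1)
      (q := fun x => c ∈ x.1.1) fun _ => Iff.rfl)]
    rw [Fintype.card_congr (Equiv.prodSubtypeFstEquivSubtypeProd
      (p := fun T : {T : Finset (Fin C) // T.card = t} => c ∈ T.1)), Fintype.card_prod,
      Fintype.card_congr (Equiv.subtypeSubtypeEquivSubtypeInter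
        (fun T : Finset (Fin C) => T.card = t) (fun T => c ∈ T)), Fintype.card_subtype]
    congr 1
    · congr 1
      ext T
      simp
    · simp
  rw [h, card_piece, ← mul_assoc t, ← card_filter_mem_powersetCard C t c]
  ring

/-! ### The scheme of a delivery design -/

/-- Multicast messages for users with the given access to the caches: the message `g` combines
the pieces `piece g k` of the users `k ∈ users g`, and every user can cancel the others' pieces. -/
structure DeliveryDesign {C K : ℕ} (access : Fin K → Finset (Fin C)) (t : ℕ) where
  Msg : Type
  [msgFintype : Fintype Msg]
  users : Msg → Finset (Fin K)
  piece : Msg → Fin K → Finset (Fin C)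
  covers : ∀ k T, T.card = t → Disjoint T (access k) → ∃ g, k ∈ users g ∧ piece g k = T ∧
    ∀ j ∈ users g, j ≠ k → ¬ Disjoint (piece g j) (access k)

attribute [instance] DeliveryDesign.msgFintype

section Symbols

variable {C t S n : ℕ} [NeZero S]

/-- The symbol `j` of the instance `i` of the part `T` of the file `m`; the symbol `0` vanishes. -/
noncomputable def symbol (W : Files (n + 1) (Fintype.card (Piece C t S n))) (m : Fin (n + 1))
    (T : Finset (Fin C)) (i : Fin n → Fin S) (j : Fin S) : ZMod 2 :=
  if h : T.card = t ∧ j ≠ 0 then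
    if W m (Fintype.equivFin (Piece C t S n) (⟨T, h.1⟩, i, ⟨j, h.2⟩)) then 1 else 0
  else 0

theorem symbol_zero (W : Files (n + 1) (Fintype.card (Piece C t S n))) (m : Fin (n + 1))
    (T : Finset (Fin C)) (i : Fin n → Fin S) : symbol W m T i 0 = 0 := by
  simp [symbol]

theorem eq_of_symbol_eq {W W' : Files (n + 1) (Fintype.card (Piece C t S n))} {m : Fin (n + 1)}
    (h : ∀ T : Finset (Fin C), T.card = t → ∀ i j, symbol W m T i j = symbol W' m T i j) :
    W m = W' m := by
  funext x
  obtain ⟨⟨T, i, j⟩, rfl⟩ := (Fintype.equivFin (Piece C t S n)).surjective x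
  have := h T.1 T.2 i j.1
  simp only [symbol, dif_pos (show T.1.card = t ∧ j.1 ≠ 0 from ⟨T.2, j.2⟩)] at this
  revert this
  cases W m (Fintype.equivFin (Piece C t S n) (T, i, j)) <;>
    cases W' m (Fintype.equivFin (Piece C t S n) (T, i, j)) <;> simp

end Symbols

namespace DeliveryDesign

variable {C K t : ℕ} {access : Fin K → Finset (Fin C)} (D : DeliveryDesign access t)
  (S n : ℕ) [NeZero S]

open Classical in
/-- The scheme that retrieves the multicast messages privately. -/
noncomputable def scheme : Scheme S (n + 1) C K (Fintype.card (Piece C t S n)) where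
  Cache c := Fin (n + 1) → {x : Fin (Fintype.card (Piece C t S n)) //
    c ∈ ((Fintype.equivFin (Piece C t S n)).symm x).1.1} → Bool
  place _ W := fun m x => W m x.1
  Rand := Fin K → Fin n → Fin S
  law _ := (Fintype.card (Fin K → Fin n → Fin S) : ℝ)⁻¹
  law_mem := ⟨fun _ => by positivity, by simp⟩
  Query _ := Fin K → Fin n → Fin S
  query s d r := fun k => r k + queryShift (d k) s
  -- The tuple `0` involves only vanishing symbols and need not be sent; this is the saving in the
  -- rate.
  Answer s := D.Msg → {q : Fin (n + 1) → Fin S // ∑ m, q m = s ∧ q ≠ 0} → ZMod 2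
  answer _ u W := fun g q => ∑ k ∈ D.users g, ∑ m,
    symbol W m (D.piece g k) (Fin.tail q.1 - u k) (q.1 m)

theorem scheme_fitsMemory {M : ℝ} (hC : 0 < C) (hM : (t : ℝ) * (n + 1) ≤ C * M) :
    (D.scheme S n).FitsMemory M := by
  intro c
  have h := card_pieces_stored C t S n c
  have hcard : Fintype.card ((D.scheme S n).Cache c) =
      2 ^ (Fintype.card {x : Fin (Fintype.card (Piece C t S n)) //
        c ∈ ((Fintype.equivFin (Piece C t S n)).symm x).1.1} * (n + 1)) := by
    change Fintype.card (Fin (n + 1) → {x : Fin (Fintype.card (Piece C t S n)) //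
      c ∈ ((Fintype.equivFin (Piece C t S n)).symm x).1.1} → Bool) = _
    simp only [Fintype.card_fun, Fintype.card_bool, Fintype.card_fin, pow_mul]
  rw [hcard, Nat.cast_pow, Nat.cast_ofNat, Real.logb_pow, Real.logb_self_eq_one one_lt_two,
    mul_one, Nat.cast_mul]
  have hC' : (0 : ℝ) < C := by exact_mod_cast hC
  generalize Fintype.card {x : Fin (Fintype.card (Piece C t S n)) //
        c ∈ ((Fintype.equivFin (Piece C t S n)).symm x).1.1} = a at h
  generalize Fintype.card (Piece C t S n) = F at h
  have h' : (a : ℝ) * C = t * F := by exact_mod_cast h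
  refine le_of_mul_le_mul_left ?_ hC'
  push_cast
  calc (C : ℝ) * (a * (n + 1)) = F * (t * (n + 1)) := by linear_combination ((n : ℝ) + 1) * h'
    _ ≤ F * (C * M) := by gcongr
    _ = C * (M * F) := by ring

theorem scheme_isPrivate : (D.scheme S n).IsPrivate := by
  classical
  refine Scheme.isPrivate_of_query_law _
    (fun _ _ => (Fintype.card (Fin K → Fin n → Fin S) : ℝ)⁻¹) ?_
  intro s d u
  change (∑ r : Fin K → Fin n → Fin S,
    if (fun k => r k + queryShift (d k) s) = u
      then (Fintype.card (Fin K → Fin n → Fin S) : ℝ)⁻¹ else 0) = _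
  -- Translation is a bijection, so exactly one `r` produces the query `u`.
  rw [Finset.sum_eq_single (fun k => u k - queryShift (d k) s)]
  · simp
  · intro r _ hr
    refine if_neg fun he => hr ?_
    rw [← he]
    simp
  · simp

theorem scheme_isCorrect : (D.scheme S n).IsCorrect access := by
  intro prior _ k
  apply condEntropy_eq_zero
  rintro ⟨d, W, r⟩ ⟨d', W', r'⟩ h
  simp only [Prod.mk.injEq] at h
  obtain ⟨rfl, hZ, hQ, hA⟩ := h
  obtain rfl : r = r' := by
    have : (fun k => r k + queryShift (d k) (0 : Fin S)) =
      (fun k => r' k + queryShift (d k) (0 : Fin S)) := congrFun hQ 0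
    funext k
    exact add_right_cancel (congrFun this k)
  have hcached : ∀ m (T : Finset (Fin C)) i j, ¬ Disjoint T (access k) →
      symbol W m T i j = symbol W' m T i j := by
    intro m T i j hT
    obtain ⟨c, hcT, hc⟩ := Finset.not_disjoint_iff.1 hT
    unfold symbol
    by_cases hTj : T.card = t ∧ j ≠ 0
    · have h1 : (fun m (x : {x : Fin (Fintype.card (Piece C t S n)) //
          c ∈ ((Fintype.equivFin (Piece C t S n)).symm x).1.1}) => W m x.1) =
          fun m x => W' m x.1 := congrFun hZ ⟨c, hc⟩
      have h2 := congrFun (congrFun h1 m)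
        ⟨Fintype.equivFin (Piece C t S n) (⟨T, hTj.1⟩, i, ⟨j, hTj.2⟩), by simpa using hcT⟩
      simp only at h2
      rw [dif_pos hTj, dif_pos hTj, h2]
    · rw [dif_neg hTj, dif_neg hTj]
  refine eq_of_symbol_eq fun T hT i j => ?_
  by_cases hd : Disjoint T (access k)
  · obtain ⟨g, hkg, rfl, hother⟩ := D.covers k T hT hd
    rw [← sub_eq_zero]
    -- Decodability is injectivity: two file contents with the same view have symbol differences
    -- that satisfy the homogeneous system.
    refine retrieve (fun m i j => symbol W m (D.piece g k) i j - symbol W' m (D.piece g k) i j)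
      (fun m i => by simp [symbol_zero]) (d k) (r k) (fun q => ?_) i j
    by_cases hq : q = 0
    · subst hq
      simp [symbol_zero]
    have h1 : ∑ k ∈ D.users g, ∑ m, symbol W m (D.piece g k)
          (Fin.tail q - (r k + queryShift (d k) (∑ l, q l))) (q m) =
        ∑ k ∈ D.users g, ∑ m, symbol W' m (D.piece g k)
          (Fin.tail q - (r k + queryShift (d k) (∑ l, q l))) (q m) :=
      congrFun (congrFun (congrFun hA (∑ l, q l)) g) ⟨q, rfl, hq⟩
    -- The other users' pieces are cached by user `k`, so they contribute equally to both sides.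
    rw [← Finset.sum_erase_add _ _ hkg, ← Finset.sum_erase_add _ _ hkg,
      Finset.sum_congr rfl (fun j hj => Finset.sum_congr rfl (fun m _ =>
        hcached m (D.piece g j) _ _
          (hother j (Finset.mem_of_mem_erase hj) (Finset.ne_of_mem_erase hj))))] at h1
    rw [Finset.sum_sub_distrib, sub_eq_zero]
    exact add_left_cancel h1
  · exact hcached _ _ _ _ hd

theorem scheme_rate_le {prior : Demand K (n + 1) → ℝ}
    (hprior : prior ∈ stdSimplex ℝ (Demand K (n + 1))) (hS : 2 ≤ S) :
    (D.scheme S n).rate prior ≤ (Fintype.card D.Msg : ℝ) / (C.choose t : ℝ) *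
      ∑ i ∈ Finset.range (n + 1), 1 / (S : ℝ) ^ i := by
  classical
  have hcard : ∀ s, Fintype.card ((D.scheme S n).Answer s) =
      2 ^ (Fintype.card {q : Fin (n + 1) → Fin S // ∑ m, q m = s ∧ q ≠ 0} *
        Fintype.card D.Msg) := by
    intro s
    change Fintype.card
      (D.Msg → {q : Fin (n + 1) → Fin S // ∑ m, q m = s ∧ q ≠ 0} → ZMod 2) = _
    simp only [Fintype.card_fun, ZMod.card, pow_mul]
  -- The servers partition the nonzero tuples by their sum.
  have hfib : ∑ s, Fintype.card {q : Fin (n + 1) → Fin S // ∑ m, q m = s ∧ q ≠ 0} =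
      S ^ (n + 1) - 1 := by
    have h1 : Fintype.card {q : Fin (n + 1) → Fin S // q ≠ 0} = S ^ (n + 1) - 1 := by
      simp
    rw [← h1, Fintype.card_subtype, Finset.card_eq_sum_card_fiberwise
      (f := fun q : Fin (n + 1) → Fin S => ∑ m, q m) (t := Finset.univ) (by simp)]
    refine Finset.sum_congr rfl fun s _ => ?_
    rw [Fintype.card_subtype, Finset.filter_filter]
    congr 1
    ext q
    simp [and_comm]
  have hS' : (2 : ℝ) ≤ S := by exact_mod_cast hS
  have hle : ∑ s, entropy ((D.scheme S n).mass prior) ((D.scheme S n).answerVar s) ≤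
      ((S : ℝ) ^ (n + 1) - 1) * Fintype.card D.Msg := by
    calc _ ≤ ∑ s, Real.logb 2 (Fintype.card ((D.scheme S n).Answer s)) :=
          Finset.sum_le_sum fun s _ => entropy_le_logb_card (Scheme.mass_mem _ hprior) _
      _ = ∑ s, (Fintype.card {q : Fin (n + 1) → Fin S // ∑ m, q m = s ∧ q ≠ 0} : ℝ) *
          Fintype.card D.Msg := by
          refine Finset.sum_congr rfl fun s _ => ?_
          rw [hcard, Nat.cast_pow, Nat.cast_ofNat, Real.logb_pow,
            Real.logb_self_eq_one one_lt_two, mul_one, Nat.cast_mul]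
      _ = _ := by
          rw [← Finset.sum_mul, ← Nat.cast_sum, hfib, Nat.cast_sub (Nat.one_le_pow _ _ (by lia))]
          push_cast
          rfl
  have hF : (Fintype.card (Piece C t S n) : ℝ) = C.choose t * (S ^ n * (S - 1)) := by
    rw [card_piece, Nat.cast_mul, Nat.cast_mul, Nat.cast_sub (by lia)]
    push_cast
    rfl
  rw [sum_range_one_div_pow (by linarith), div_mul_div_comm, ← hF,
    mul_comm (Fintype.card D.Msg : ℝ), Scheme.rate]
  gcongr

end DeliveryDesign

theorem DeliveryDesign.achievable {C K t : ℕ} {access : Fin K → Finset (Fin C)}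
    (D : DeliveryDesign access t) {S n : ℕ} {M : ℝ} (hS : 2 ≤ S) (hC : 0 < C) (htC : t ≤ C)
    (hM : (t : ℝ) * (n + 1) ≤ C * M) :
    Achievable S (n + 1) M access ((Fintype.card D.Msg : ℝ) / (C.choose t : ℝ) *
      ∑ i ∈ Finset.range (n + 1), 1 / (S : ℝ) ^ i) := by
  have : NeZero S := ⟨by lia⟩
  refine ⟨Fintype.card (Piece C t S n), ?_, D.scheme S n, D.scheme_fitsMemory S n hC hM,
    D.scheme_isPrivate S n, D.scheme_isCorrect S n, fun prior h => D.scheme_rate_le S n h hS⟩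
  rw [card_piece]
  exact Nat.mul_pos (Nat.choose_pos htC) (Nat.mul_pos (by positivity) (by lia))

/-! ### The two designs and the theorem -/

/-- The dedicated-cache design, in which user `k` relies on cache `k` only. -/
def dedicatedDesign {C : ℕ} {access : Fin C → Finset (Fin C)} (h : ∀ k, k ∈ access k) (t : ℕ) :
    DeliveryDesign access t where
  Msg := {g : Finset (Fin C) // g.card = t + 1}
  users g := g.1
  piece g k := g.1.erase k
  covers k T hT hd := by
    have hk : k ∉ T := Finset.disjoint_right.1 hd (h k)
    refine ⟨⟨insert k T, by rw [Finset.card_insert_of_notMem hk, hT]⟩,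
      Finset.mem_insert_self _ _, Finset.erase_insert hk, fun j _ hjk => ?_⟩
    exact Finset.not_disjoint_iff.2
      ⟨k, Finset.mem_erase.2 ⟨hjk.symm, Finset.mem_insert_self _ _⟩, h k⟩

theorem mem_window_self {C L : ℕ} (hL : 1 ≤ L) (k : Fin C) : k ∈ window C L k := by
  simp only [window, Finset.mem_filter, Finset.mem_univ, true_and]
  exact ⟨0, hL, by simp [Nat.mod_eq_of_lt k.2]⟩

theorem card_window {C L : ℕ} (hLC : L < C) (k : Fin C) : (window C L k).card = L := by
  have : window C L k = (Finset.univ : Finset (Fin L)).image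
      (fun i => (⟨(k.val + i.val) % C, Nat.mod_lt _ (by lia)⟩ : Fin C)) := by
    ext c
    simp only [window, Finset.mem_filter, Finset.mem_univ, true_and, Finset.mem_image, Fin.ext_iff]
    constructor
    · rintro ⟨i, hi, h⟩
      exact ⟨⟨i, hi⟩, h.symm⟩
    · rintro ⟨i, h⟩
      exact ⟨i, i.2, h.symm⟩
  rw [this, Finset.card_image_of_injective, Finset.card_univ, Fintype.card_fin]
  intro i j hij
  have h : k.val + i.val ≡ k.val + j.val [MOD C] := Fin.ext_iff.1 hij
  have := Nat.ModEq.add_left_cancel' _ h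
  exact Fin.ext (Nat.ModEq.eq_of_lt_of_lt this (by lia) (by lia))

/-- If `k` lies in the window of `j`, the window of `k` reaches the position `j + L`, which as `L <
C` is outside that of `j`. -/
theorem window_not_subset {C L : ℕ} (hL : 1 ≤ L) (hLC : L < C) {j k : Fin C} (hjk : j ≠ k) :
    ¬ window C L k ⊆ window C L j := by
  intro hsub
  have hk := hsub (mem_window_self hL k)
  simp only [window, Finset.mem_filter, Finset.mem_univ, true_and] at hk
  obtain ⟨i, hi, hki⟩ := hk
  have hi0 : 0 < i := by
    rcases Nat.eq_zero_or_pos i with rfl | h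
    · exact absurd (Fin.ext (by rw [hki, add_zero, Nat.mod_eq_of_lt j.2])) hjk
    · exact h
  have hmem : (⟨(j.val + L) % C, Nat.mod_lt _ (by lia)⟩ : Fin C) ∈ window C L k := by
    simp only [window, Finset.mem_filter, Finset.mem_univ, true_and]
    refine ⟨L - i, by lia, ?_⟩
    rw [hki, Nat.mod_add_mod]
    congr 1
    lia
  have hmem' := hsub hmem
  simp only [window, Finset.mem_filter, Finset.mem_univ, true_and] at hmem'
  obtain ⟨l, hl, h⟩ := hmem'
  have h' : j.val + L ≡ j.val + l [MOD C] := h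
  have := Nat.ModEq.eq_of_lt_of_lt (Nat.ModEq.add_left_cancel' _ h') hLC (by lia)
  lia

/-- The design in which the messages are the sets of `t + L` caches that contain all the caches
of some user. -/
def windowDesign {C L : ℕ} (hL : 1 ≤ L) (hLC : L < C) (t : ℕ) :
    DeliveryDesign (fun k : Fin C => window C L k) t where
  Msg := {A // A ∈ ((Finset.univ : Finset (Fin C)).powersetCard (t + L)).filter
    fun A => ∃ j, window C L j ⊆ A}
  users A := Finset.univ.filter fun k => window C L k ⊆ A.1
  piece A k := A.1 \ window C L k
  covers k T hT hd := by
    refine ⟨⟨T ∪ window C L k, ?_⟩, ?_, ?_, ?_⟩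
    · rw [Finset.mem_filter, Finset.mem_powersetCard, Finset.card_union_of_disjoint hd, hT,
        card_window hLC]
      exact ⟨⟨Finset.subset_univ _, rfl⟩, k, Finset.subset_union_right⟩
    · simp
    · exact Finset.union_sdiff_cancel_right hd
    · intro j _ hjk
      -- A cache of user `k` outside the window of `j` lies in the piece meant for `j`.
      obtain ⟨c, hck, hcj⟩ := Finset.not_subset.1 (window_not_subset hL hLC hjk)
      exact Finset.not_disjoint_iff.2
        ⟨c, Finset.mem_sdiff.2 ⟨Finset.mem_union_right _ hck, hcj⟩, hck⟩

end MuPIR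

theorem theorem3 (S N C L t : ℕ) (M : ℝ) (hS : 2 ≤ S) (hN : 1 ≤ N) (hL : 1 ≤ L) (hLC : L < C)
    (ht : (t : ℝ) = C * M / N) (htC : t ≤ C) :
    MuPIR.Achievable S N M (fun k : Fin C => MuPIR.window C L k)
      (min (((C : ℝ) - t) / (t + 1)) ((MuPIR.cyc C (t + L) L : ℝ) / (C.choose t : ℝ)) *
        ∑ i ∈ Finset.range N, 1 / (S : ℝ) ^ i) := by
  obtain ⟨n, rfl⟩ : ∃ n, N = n + 1 := ⟨N - 1, by lia⟩
  have hM : (t : ℝ) * (n + 1) ≤ C * M := by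
    rw [ht]
    push_cast
    rw [div_mul_cancel₀ _ (by positivity)]
  rcases min_choice (((C : ℝ) - t) / (t + 1))
    ((MuPIR.cyc C (t + L) L : ℝ) / (C.choose t : ℝ)) with h | h
  · have := (MuPIR.dedicatedDesign (access := fun k : Fin C => MuPIR.window C L k)
      (MuPIR.mem_window_self hL) t).achievable hS (by lia) htC hM
    have hcard : (Fintype.card (MuPIR.dedicatedDesign (access := fun k : Fin C =>
        MuPIR.window C L k) (MuPIR.mem_window_self hL) t).Msg : ℝ) / (C.choose t : ℝ) =
        ((C : ℝ) - t) / (t + 1) := by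
      change (Fintype.card {g : Finset (Fin C) // g.card = t + 1} : ℝ) / (C.choose t : ℝ) = _
      rw [Fintype.card_finset_len, Fintype.card_fin]
      have hpos : (0 : ℝ) < C.choose t := by exact_mod_cast Nat.choose_pos htC
      rw [div_eq_div_iff hpos.ne' (by positivity), ← Nat.cast_sub htC]
      rw [mul_comm ((C - t : ℕ) : ℝ)]
      exact_mod_cast Nat.choose_succ_right_eq C t
    rwa [hcard, ← h] at this
  · have := (MuPIR.windowDesign hL hLC t).achievable hS (by lia) htC hM
    have hcard : Fintype.card (MuPIR.windowDesign hL hLC t).Msg = MuPIR.cyc C (t + L) L := by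
      change Fintype.card {A // A ∈ ((Finset.univ : Finset (Fin C)).powersetCard (t + L)).filter
        fun A => ∃ j, MuPIR.window C L j ⊆ A} = _
      rw [Fintype.card_coe]
      rfl
    rwa [hcard, ← h] at this
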